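/- Let $S$ be a finite set with $\kappa=|S|\ge 2$ and let $\alpha>1$. Let $r(x,y)\ge 0$, $x\ne y\in S$, be the jump rates of an irreducible continuous-time Markov process on $S$, with $r(x,x)=-\sum_{y\neq x}r(x,y)$. Assume that either (i) (reversible case) $r(x,y)=r(y,x)$ for all $x,y\in S$; or (ii) (general, possibly non-reversible case) the uniform measure on $S$ is invariant, i.e. $\sum_{y\in S}\kappa^{-1}r(y,x)=0$ for all $x\in S$. Put $a(0)=1$, $a(n)=n^\alpha$ for $n\ge1$, and $g(0)=1$, $g(n)=a(n)/a(n-1)$ for $n\geq 1$. For $N\in\mathbb N$ let $\mathcal H_N=\{\eta\in\mathbb N^S:\sum_{x}\eta_x=N\}$, and let $$(\mathscr L_N f)(\eta)=\sum_{x,y\in S}g(\eta_x)\,r(x,y)\,\big(f(\eta^{x,y})-f(\eta)\big),\qquad f:\mathcal H_N\to\mathbb R,$$ be the generator of the zero-range process, where $\eta^{x,y}$ is obtained from $\eta$ by moving one particle from $x$ to $y$ if $\eta_x\ge1$, and $\eta^{x,y}=\eta$ if $\eta_x=0$ or $x=y$. For a probability measure $\nu$ on $\mathcal H_N$ let $$I_N(\nu)=\sup_{u:\mathcal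 H_N\to(0,\infty)}\int_{\mathcal H_N}-\frac{\mathscr L_N u}{u}\,d\nu .$$ Let $(\ell_N)$ be a sequence of natural numbers with $\ell_N\to\infty$ and $\ell_N/N\to0$, and set $\mathcal E_N^x=\{\eta\in\mathcal H_N:\eta_x\ge N-\ell_N\}$ for $x\in S$ and $\Delta_N=\mathcal H_N\setminus\bigcup_{x\in S}\mathcal E_N^x$. Then for every strictly increasing sequence $(N_k)$ of natural numbers, all probability measures $\nu_{N_k}$ on $\mathcal H_{N_k}$, and every $C>0$: if $N_k^{1+\alpha}I_{N_k}(\nu_{N_k})<C$ for all $k$, then $$\lim_{k\to\infty}\nu_{N_k}(\Delta_{N_k})=0 .$$ In other words, the accelerated generators $A_N=N^{1+\alpha}\mathscr L_N$ and the sets $(\mathcal E_N^x)_{x\in S}$ satisfy condition (M0*): for every strictly increasing sequence $(N_k)$ of positive integers and all probability measures $\nu_{N_k}$ on $\mathcal H_{N_k}$, $$\sup_{k}\ \sup_{u:\mathcal H_{N_k}\to(0,\infty)}\int-\frac{A_{N_k}u}{u}\,d\nu_{N_k}<\infty\quad\text{implies}\quad\limsup_{k\to\infty}\nu_{N_k}(\Delta_{N_k})=0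 .$$ -/

import Mathlib

open MeasureTheory Filter Topology

noncomputable section

namespace ZeroRange

/-- Configurations of `N` particles on the finite site space `S`. The sigma-algebra is the one
inherited from `S → ℕ`, in which every set of configurations is measurable. -/
abbrev Config (S : Type*) [Fintype S] (N : ℕ) : Type _ :=
  {η : S → ℕ // ∑ x, η x = N}

/-- `a(0) = 1` and `a(n) = n ^ α` for `n ≥ 1`. -/
def a (α : ℝ) (n : ℕ) : ℝ := if n = 0 then 1 else (n : ℝ) ^ α

/-- `g(0) = 1` and `g(n) = a(n) / a(n - 1)` for `n ≥ 1`. -/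
def g (α : ℝ) (n : ℕ) : ℝ := if n = 0 then 1 else a α n / a α (n - 1)

/-- The configuration `η^{x,y}`: one particle is sent from `x` to `y` if there is a particle at
`x`, and nothing happens otherwise. In particular `η^{x,x} = η`. -/
def Config.move {S : Type*} [Fintype S] [DecidableEq S] {N : ℕ}
    (η : Config S N) (x y : S) : Config S N :=
  ⟨if η.1 x = 0 then η.1 else fun z =>
      (η.1 z - if z = x then 1 else 0) + if z = y then 1 else 0, by
    have hsum := η.2
    split_ifs with h
    · exact hsum
    · have h1 : ∀ z, (η.1 z - if z = x then 1 else 0) + (if z = x then 1 else 0) = η.1 z := by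
        intro z
        by_cases hz : z = x
        · subst hz
          simp only [if_true]
          omega
        · simp [hz]
      have h2 : (∑ z, (η.1 z - if z = x then 1 else 0)) + 1 = N := by
        have h3 := (Finset.sum_congr rfl (fun z _ => h1 z)).trans hsum
        rw [Finset.sum_add_distrib] at h3
        simpa using h3
      rw [Finset.sum_add_distrib]
      simpa using h2⟩

/-- `r` is the rate matrix of a continuous-time irreducible Markov process on `S`: nonnegative
off the diagonal, with `r(x,x) = - ∑_{y ≠ x} r(x,y)`, and any site can be reached from any other
site through jumps of positive rate. -/
structure IsIrreducibleRates {S : Type*} [Fintype S] [DecidableEq S] (r : S → S → ℝ) : Prop where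
  nonneg : ∀ x y, x ≠ y → 0 ≤ r x y
  diag : ∀ x, r x x = -∑ y ∈ Finset.univ.erase x, r x y
  irreducible : ∀ x y, Relation.ReflTransGen (fun z w => z ≠ w ∧ 0 < r z w) x y

/-- `m` is invariant for the process on `S` with rate matrix `r`. -/
def IsInvariant {S : Type*} [Fintype S] (r : S → S → ℝ) (m : S → ℝ) : Prop :=
  ∀ x, ∑ y, m y * r y x = 0

/-- The generator of the zero-range process with `N` particles. The terms with `x = y` vanish. -/
def generator {S : Type*} [Fintype S] [DecidableEq S] (α : ℝ) (r : S → S → ℝ) (N : ℕ)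
    (f : Config S N → ℝ) (η : Config S N) : ℝ :=
  ∑ x, ∑ y, g α (η.1 x) * r x y * (f (η.move x y) - f η)

/-- The level-two large deviation rate function of a generator `A` on a finite state space `X`:
the supremum over all positive `u` of the integral of `- A u / u`. -/
def rateFunction {X : Type*} [MeasurableSpace X] (A : (X → ℝ) → X → ℝ)
    (ν : ProbabilityMeasure X) : EReal :=
  ⨆ u : {u : X → ℝ // ∀ η, 0 < u η}, ((∫ η, -(A u.1 η / u.1 η) ∂(ν : Measure X) : ℝ) : EReal)

/-- The valley at the site `x`: configurations with at least `N - ℓ` particles at `x`. -/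
def valley {S : Type*} [Fintype S] (N ℓ : ℕ) (x : S) : Set (Config S N) :=
  {η | (N : ℤ) - (ℓ : ℤ) ≤ (η.1 x : ℤ)}

/-- The complement of the union of a family of valleys. -/
def outside {S X : Type*} (E : S → Set X) : Set X := (⋃ x, E x)ᶜ

/-- Condition (M0*) for generators `A N` on `X N` and valleys `E N x`: probability measures along
a subsequence with bounded rate function asymptotically give no mass to the complement of the
valleys. -/
def ConditionM0Star {S : Type*} {X : ℕ → Type*} [∀ N, MeasurableSpace (X N)]
    (A : ∀ N, (X N → ℝ) → X N → ℝ) (E : ∀ N, S → Set (X N)) : Prop :=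
  ∀ n : ℕ → ℕ, StrictMono n → (∀ k, 0 < n k) →
    ∀ ν : ∀ k, ProbabilityMeasure (X (n k)),
      (⨆ k, rateFunction (A (n k)) (ν k)) < ⊤ →
        limsup (fun k => (ν k : Measure (X (n k))) (outside (E (n k)))) atTop = 0

end ZeroRange

end

namespace ZeroRange

/-! In both cases all row and column sums of `r` vanish, so ∏_z 1/a(η_z) is an invariant weight.
Testing the rate function with u = h + ε, where h is the square root of the density of ν, and
letting ε → 0 bounds the Dirichlet form of h by I_N(ν), without reversibility
(`sum_sqrtDensity_drift_le`). Removing the jumping particle splits this form into Dirichlet forms on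
S of z ↦ h(ξ + δ_z), with ξ having one particle less; irreducibility then bounds the energy between
any two sites, as if all jumps were allowed (`exists_bondEnergy_le`).

Some site x holds at least N/κ particles. Send the others to x, one site at a time (`pour`).
Emptying one site lowers the weight by at most the factor κ^α, so a path argument bounds the
weighted sum of (h(η) - h(Nδ_x))² by a constant times N² times the energy. Normalisation gives
h(Nδ_x)² ≤ a(N), while the configurations outside the valleys weigh at most a constant times 1/a(N)
times a tail of ∑ 1/a(k), convergent since α > 1. Hence ν(Δ_N) ≤ K (N² I_N(ν) + tail)
(`exists_real_outside_valley_le`), and I_N(ν) ≤ C N^{-1-α} makes the first term O(N^{1-α}). -/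

theorem a_pos (α : ℝ) (n : ℕ) : 0 < a α n := by
  unfold a
  split_ifs with h
  · exact one_pos
  · exact Real.rpow_pos_of_pos (by exact_mod_cast Nat.pos_of_ne_zero h) _

theorem a_mono {α : ℝ} (hα : 0 ≤ α) {m n : ℕ} (hmn : m ≤ n) : a α m ≤ a α n := by
  unfold a
  split_ifs with h h' h'
  · exact le_rfl
  · exact Real.one_le_rpow (by exact_mod_cast Nat.one_le_iff_ne_zero.2 h') hα
  · omega
  · exact Real.rpow_le_rpow (by positivity) (by exact_mod_cast hmn) hα

theorem a_le_of_le_mul {α : ℝ} (hα : 0 ≤ α) {c m n : ℕ} (hc : 1 ≤ c) (hmn : n ≤ c * m) :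
    a α n ≤ (c : ℝ) ^ α * a α m := by
  have hc' : (1 : ℝ) ≤ (c : ℝ) ^ α := Real.one_le_rpow (by exact_mod_cast hc) hα
  rcases Nat.eq_zero_or_pos m with rfl | hm
  · obtain rfl : n = 0 := by simpa using hmn
    exact le_mul_of_one_le_left (a_pos α 0).le hc'
  · refine (a_mono hα hmn).trans (le_of_eq ?_)
    have h1 : c * m ≠ 0 := by positivity
    simp only [a, h1, hm.ne', if_false]
    push_cast
    exact Real.mul_rpow (by positivity) (by positivity)

theorem summable_inv_a {α : ℝ} (hα : 1 < α) : Summable fun n => (a α n)⁻¹ := by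
  rw [← summable_nat_add_iff 1]
  refine ((summable_nat_add_iff 1).2 (Real.summable_nat_rpow_inv.2 hα)).congr fun n => ?_
  simp [a]

/-- A nonnegative real sequence has partial sums over the indices `k ≥ L` below its tail sum. -/
theorem sum_range_ite_le_tsum_add {f : ℕ → ℝ} (hf : Summable f) (h0 : ∀ n, 0 ≤ f n) (L n : ℕ) :
    ∑ k ∈ Finset.range n, (if L ≤ k then 1 else 0) * f k ≤ ∑' i, f (i + L) := by
  have hs : Summable fun i => f (i + L) := (summable_nat_add_iff L).2 hf
  have h1 : ∑ k ∈ Finset.range n, (if L ≤ k then 1 else 0) * f k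
      = ∑ k ∈ (Finset.range n).filter (L ≤ ·), f k := by
    simp [Finset.sum_filter]
  rw [h1]
  calc ∑ k ∈ (Finset.range n).filter (L ≤ ·), f k
      ≤ ∑ k ∈ (Finset.range n).image (· + L), f k := by
        refine Finset.sum_le_sum_of_subset_of_nonneg (fun k hk => ?_) fun _ _ _ => h0 _
        simp only [Finset.mem_filter, Finset.mem_range] at hk
        exact Finset.mem_image.2 ⟨k - L, by simp; omega, by omega⟩
    _ = ∑ i ∈ Finset.range n, f (i + L) := Finset.sum_image fun i _ j _ h => by simpa using h
    _ ≤ _ := hs.sum_le_tsum _ fun _ _ => h0 _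

/-- The Dirichlet form of a doubly stochastic rate matrix. -/
theorem dirichlet_form_eq {S : Type*} [Fintype S] {r : S → S → ℝ} (h1 : ∀ x, ∑ y, r x y = 0) (h2 : ∀ y, ∑ x, r x y = 0)
    (F : S → ℝ) :
    ∑ x, ∑ y, r x y * (F x * (F x - F y)) = 2⁻¹ * ∑ x, ∑ y, r x y * (F x - F y) ^ 2 := by
  have e1 : ∑ x, ∑ y, r x y * F x ^ 2 = 0 := by
    simp [← Finset.sum_mul, h1]
  have e2 : ∑ x, ∑ y, r x y * F y ^ 2 = 0 := by
    rw [Finset.sum_comm]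
    simp [← Finset.sum_mul, h2]
  have e3 : ∑ x, ∑ y, r x y * (F x - F y) ^ 2 = ∑ x, ∑ y, r x y * F x ^ 2
      + ∑ x, ∑ y, r x y * F y ^ 2 - 2 * ∑ x, ∑ y, r x y * (F x * F y) := by
    simp only [Finset.mul_sum, ← Finset.sum_add_distrib, ← Finset.sum_sub_distrib]
    exact Finset.sum_congr rfl fun _ _ => Finset.sum_congr rfl fun _ _ => by ring
  have e4 : ∑ x, ∑ y, r x y * (F x * (F x - F y)) = ∑ x, ∑ y, r x y * F x ^ 2
      - ∑ x, ∑ y, r x y * (F x * F y) := by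
    simp only [← Finset.sum_sub_distrib]
    exact Finset.sum_congr rfl fun _ _ => Finset.sum_congr rfl fun _ _ => by ring
  rw [e3, e4, e1, e2]
  ring

/-! ### Dirichlet form on the site space. -/

section Rates

variable {S : Type*} [Fintype S] [DecidableEq S]

theorem IsIrreducibleRates.sum_eq_zero {r : S → S → ℝ} (hr : IsIrreducibleRates r) (x : S) :
    ∑ y, r x y = 0 := by
  rw [← Finset.add_sum_erase _ _ (Finset.mem_univ x), hr.diag x]
  ring

/-- The Dirichlet form of an irreducible doubly stochastic rate matrix controls the increments of
a function between any two sites. -/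
theorem IsIrreducibleRates.exists_sq_sub_le {r : S → S → ℝ} (hr : IsIrreducibleRates r)
    (h2 : ∀ y, ∑ x, r x y = 0) :
    ∃ K : ℝ, 0 ≤ K ∧ ∀ (F : S → ℝ) (x y : S),
      (F x - F y) ^ 2 ≤ K * ∑ z, ∑ w, r z w * (F z * (F z - F w)) := by
  have hterm : ∀ (F : S → ℝ) (z w : S), 0 ≤ r z w * (F z - F w) ^ 2 := fun F z w => by
    by_cases hzw : z = w
    · simp [hzw]
    · exact mul_nonneg (hr.nonneg z w hzw) (sq_nonneg _)
  have hE : ∀ F : S → ℝ, 0 ≤ ∑ z, ∑ w, r z w * (F z - F w) ^ 2 := fun F =>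
    Finset.sum_nonneg fun z _ => Finset.sum_nonneg fun w _ => hterm F z w
  have key : ∀ x y, ∃ K : ℝ, 0 ≤ K ∧ ∀ F : S → ℝ,
      (F x - F y) ^ 2 ≤ K * ∑ z, ∑ w, r z w * (F z - F w) ^ 2 := fun x y => by
    induction hr.irreducible x y with
    | refl => exact ⟨0, le_rfl, fun F => by simp⟩
    | @tail z w _ hzw ih =>
      obtain ⟨K, hK, h⟩ := ih
      -- Adding one edge to the path costs (a + b)² ≤ 2a² + 2b².
      refine ⟨2 * K + 2 * (r z w)⁻¹, by have := hzw.2; positivity, fun F => ?_⟩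
      have h1 : r z w * (F z - F w) ^ 2 ≤ ∑ z, ∑ w, r z w * (F z - F w) ^ 2 :=
        (Finset.single_le_sum (f := fun w => r z w * (F z - F w) ^ 2)
          (fun w _ => hterm F z w) (Finset.mem_univ w)).trans
        (Finset.single_le_sum (f := fun z => ∑ w, r z w * (F z - F w) ^ 2)
          (fun z _ => Finset.sum_nonneg fun w _ => hterm F z w) (Finset.mem_univ z))
      have h3 : (F z - F w) ^ 2 ≤ (r z w)⁻¹ * ∑ z, ∑ w, r z w * (F z - F w) ^ 2 := by
        rw [inv_mul_eq_div, le_div_iff₀ hzw.2]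
        linarith
      nlinarith [h F, sq_nonneg ((F x - F z) - (F z - F w))]
  choose K hK h using key
  -- The sum over all pairs makes the constant uniform; the 2 undoes the 2⁻¹ of `dirichlet_form_eq`.
  refine ⟨2 * ∑ x, ∑ y, K x y, mul_nonneg zero_le_two
    (Finset.sum_nonneg fun x _ => Finset.sum_nonneg fun y _ => hK x y), fun F x y => ?_⟩
  rw [dirichlet_form_eq hr.sum_eq_zero h2]
  have h1 : K x y ≤ ∑ x, ∑ y, K x y :=
    (Finset.single_le_sum (f := fun y => K x y) (fun y _ => hK x y) (Finset.mem_univ y)).trans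
    (Finset.single_le_sum (f := fun x => ∑ y, K x y)
      (fun x _ => Finset.sum_nonneg fun y _ => hK x y) (Finset.mem_univ x))
  calc _ ≤ _ := h x y F
    _ ≤ _ := mul_le_mul_of_nonneg_right h1 (hE F)
    _ = _ := by ring

end Rates

theorem sum_le_sum_of_injOn {ι ι' : Type*} {s : Finset ι} {t : Finset ι'} {f : ι → ℝ} {g : ι' → ℝ}
    (e : ι → ι') (he : Set.InjOn e s) (hst : ∀ i ∈ s, e i ∈ t) (hg : ∀ j ∈ t, 0 ≤ g j)
    (h : ∀ i ∈ s, f i ≤ g (e i)) : ∑ i ∈ s, f i ≤ ∑ j ∈ t, g j := by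
  classical
  calc ∑ i ∈ s, f i ≤ ∑ i ∈ s, g (e i) := Finset.sum_le_sum h
    _ = ∑ j ∈ s.image e, g j := (Finset.sum_image he).symm
    _ ≤ _ := Finset.sum_le_sum_of_subset_of_nonneg (Finset.image_subset_iff.2 hst)
        fun j hj _ => hg j hj

/-! ### Moving particles between two sites. -/

section Transfer

variable {S : Type*} [DecidableEq S]

/-- Take `i` particles away from `y` and put `j` particles on `x`. -/
def transfer (x y : S) (i j : ℕ) (η : S → ℕ) : S → ℕ := fun z =>
  if z = y then η y - i else if z = x then η x + j else η z

/-- The restriction to i ≤ η y is what keeps truncated subtraction invertible. -/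
theorem transfer_injOn {x y : S} (hxy : y ≠ x) (i j : ℕ) :
    Set.InjOn (transfer x y i j) {η | i ≤ η y} := by
  intro η hη ζ hζ h
  ext z
  have hz := congrFun h z
  simp only [transfer, Set.mem_ofPred_eq] at hz hη hζ
  split_ifs at hz with h1 h2
  · subst h1; omega
  · subst h2; omega
  · exact hz

/-- Together with `transfer_add_single_right`, this writes two consecutive points of the path from η
to `pour x y η` as ξ + δ_y and ξ + δ_x with a common ξ, the form of the terms in `bondEnergy`. -/
theorem transfer_add_single_left {x y : S} (hxy : y ≠ x) (i j : ℕ) (η : S → ℕ) :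
    transfer x y i j η + Pi.single x 1 = transfer x y i (j + 1) η := by
  ext z
  by_cases h1 : z = y
  · subst h1; simp [transfer, hxy]
  · by_cases h2 : z = x
    · subst h2; simp [transfer, h1, add_assoc]
    · simp [transfer, h1, h2]

theorem transfer_add_single_right {x y : S} {i : ℕ} (j : ℕ) {η : S → ℕ}
    (hi : i < η y) : transfer x y (i + 1) j η + Pi.single y 1 = transfer x y i j η := by
  ext z
  by_cases h1 : z = y
  · subst h1; simp [transfer]; omega
  · simp [transfer, h1]

theorem transfer_zero (x y : S) (η : S → ℕ) : transfer x y 0 0 η = η := by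
  ext z
  simp only [transfer]
  split_ifs with h h' <;> simp_all

/-- All particles of `y` are sent to `x`. -/
def pour (x y : S) (η : S → ℕ) : S → ℕ := transfer x y (η y) (η y) η

end Transfer

/-! ### Stationary weights and the cost of emptying one site. -/

section Weights

variable {S : Type*} [Fintype S]

/-- The unnormalised stationary weight of a configuration. -/
noncomputable def weight (α : ℝ) (η : S → ℕ) : ℝ := ∏ z, (a α (η z))⁻¹

theorem weight_pos (α : ℝ) (η : S → ℕ) : 0 < weight α η :=
  Finset.prod_pos fun _ _ => inv_pos.2 (a_pos _ _)

theorem weight_le_mul {α : ℝ} {η ζ : S → ℕ} (c : S → ℝ)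
    (h : ∀ z, (a α (η z))⁻¹ ≤ c z * (a α (ζ z))⁻¹) :
    weight α η ≤ (∏ z, c z) * weight α ζ := by
  rw [weight, weight, ← Finset.prod_mul_distrib]
  exact Finset.prod_le_prod (fun z _ => (inv_pos.2 (a_pos _ _)).le) fun z _ => h z

variable [DecidableEq S]

/-- The configurations of `N` particles, as a finset of functions. -/
def configs (S : Type*) [Fintype S] [DecidableEq S] (N : ℕ) : Finset (S → ℕ) :=
  Finset.piAntidiag Finset.univ N

@[simp] theorem mem_configs {N : ℕ} {η : S → ℕ} : η ∈ configs S N ↔ ∑ z, η z = N := by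
  simp [configs]

theorem le_of_mem_configs {N : ℕ} {η : S → ℕ} (h : η ∈ configs S N) (x : S) : η x ≤ N := by
  rw [mem_configs] at h
  exact h ▸ Finset.single_le_sum (f := η) (fun _ _ => Nat.zero_le _) (Finset.mem_univ x)

/-- The configurations of `N` particles with at least the average occupation at `x`. -/
def crowded (N : ℕ) (x : S) : Finset (S → ℕ) :=
  (configs S N).filter fun η => N ≤ Fintype.card S * η x

theorem mem_crowded {N : ℕ} {x : S} {η : S → ℕ} :
    η ∈ crowded N x ↔ ∑ z, η z = N ∧ N ≤ Fintype.card S * η x := by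
  simp [crowded]

theorem exists_mem_crowded [Nonempty S] {N : ℕ} {η : S → ℕ} (h : η ∈ configs S N) :
    ∃ x, η ∈ crowded N x := by
  rw [mem_configs] at h
  by_contra! hx
  simp only [mem_crowded, h, true_and, not_le] at hx
  have h1 : ∑ x : S, Fintype.card S * η x < ∑ _x : S, N :=
    Finset.sum_lt_sum_of_nonempty Finset.univ_nonempty fun x _ => hx x
  rw [← Finset.mul_sum, h] at h1
  simp at h1

theorem sum_transfer {x y : S} (hxy : y ≠ x) {i j : ℕ} {η : S → ℕ} (hi : i ≤ η y) :
    ∑ z, transfer x y i j η z + i = ∑ z, η z + j := by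
  have hy : y ∈ Finset.univ.erase x := by simp [hxy]
  have h1 : ∀ f : S → ℕ, ∑ z, f z = f x + (f y + ∑ z ∈ (Finset.univ.erase x).erase y, f z) :=
    fun f => by rw [Finset.add_sum_erase _ _ hy, Finset.add_sum_erase _ _ (Finset.mem_univ x)]
  have h2 : ∑ z ∈ (Finset.univ.erase x).erase y, transfer x y i j η z
      = ∑ z ∈ (Finset.univ.erase x).erase y, η z := by
    refine Finset.sum_congr rfl fun z hz => ?_
    simp only [Finset.mem_erase] at hz
    simp [transfer, hz.1, hz.2.1]
  rw [h1 η, h1, h2]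
  simp only [transfer, hxy.symm, if_true, if_false]
  omega

theorem pour_mem_crowded {N : ℕ} {x y : S} (hxy : y ≠ x) {η : S → ℕ} (hη : η ∈ crowded N x) :
    pour x y η ∈ crowded N x := by
  rw [mem_crowded] at hη ⊢
  have h1 := sum_transfer hxy (j := η y) (le_refl (η y))
  refine ⟨by rw [pour]; omega, hη.2.trans (Nat.mul_le_mul_left _ ?_)⟩
  simp [pour, transfer, hxy.symm]

theorem inv_a_le_of_crowded {α : ℝ} (hα : 0 ≤ α) {N n : ℕ} {x : S} {η : S → ℕ}
    (hη : η ∈ crowded N x) (hn : n ≤ N) :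
    (a α (η x))⁻¹ ≤ (Fintype.card S : ℝ) ^ α * (a α n)⁻¹ := by
  have hc : 1 ≤ Fintype.card S := Fintype.card_pos_iff.2 ⟨x⟩
  rw [← div_eq_mul_inv, le_div_iff₀ (a_pos _ _), inv_mul_le_iff₀ (a_pos _ _), mul_comm]
  exact a_le_of_le_mul hα hc (hn.trans (mem_crowded.1 hη).2)

/-- The factor at y becomes 1/a(0) = 1, and the factor at x drops by at most κ^α because x already
holds an average share. -/
theorem weight_le_pour {α : ℝ} (hα : 0 ≤ α) {N : ℕ} {x y : S} (hxy : y ≠ x) {η : S → ℕ}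
    (hη : η ∈ crowded N x) :
    weight α η ≤ (Fintype.card S : ℝ) ^ α * (a α (η y))⁻¹ * weight α (pour x y η) := by
  have h := weight_le_mul (α := α) (η := η) (ζ := pour x y η)
    (fun z => (if z = x then (Fintype.card S : ℝ) ^ α else 1) *
      (if z = y then (a α (η y))⁻¹ else 1)) fun z => ?_
  · rwa [Finset.prod_mul_distrib, Finset.prod_ite_eq' , Finset.prod_ite_eq', if_pos (Finset.mem_univ _),
      if_pos (Finset.mem_univ _)] at h
  · by_cases h1 : z = y
    · subst h1; simp [hxy, pour, transfer, a]
    · by_cases h2 : z = x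
      · subst h2
        simp only [h1, if_true, if_false, mul_one]
        refine inv_a_le_of_crowded hα hη ?_
        have := pour_mem_crowded hxy hη
        exact le_of_mem_configs (Finset.mem_filter.1 this).1 z
      · simp [h1, h2, pour, transfer]

/-- The pair (η y, `pour x y η`) determines η, so the sum embeds in a product of sums. The choice φ
= 1 serves to iterate pourings; the indicator of k ≥ M produces the tail. -/
theorem sum_crowded_pour_le {α : ℝ} (hα : 0 ≤ α) {N : ℕ} {x y : S} (hxy : y ≠ x) {φ : ℕ → ℝ}
    (hφ : ∀ k, 0 ≤ φ k) {Φ : (S → ℕ) → ℝ} (hΦ : ∀ η, 0 ≤ Φ η) :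
    ∑ η ∈ crowded N x, weight α η * (φ (η y) * Φ (pour x y η)) ≤
      (Fintype.card S : ℝ) ^ α * (∑ k ∈ Finset.range (N + 1), φ k * (a α k)⁻¹) *
        ∑ η ∈ crowded N x, weight α η * Φ η := by
  rw [Finset.mul_sum (Finset.range (N + 1)), Finset.sum_mul_sum, ← Finset.sum_product']
  refine sum_le_sum_of_injOn (fun η => (η y, pour x y η)) ?_ ?_ ?_ ?_
  · intro η _ ζ _ h
    simp only [Prod.mk.injEq] at h
    obtain ⟨h1, h2⟩ := h
    refine transfer_injOn hxy (η y) (η y) (show η y ≤ η y from le_rfl)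
      (show η y ≤ ζ y from h1.le) ?_
    rw [pour, pour, ← h1] at h2
    exact h2
  · intro η hη
    simp only [Finset.mem_product, Finset.mem_range]
    exact ⟨Nat.lt_succ_of_le (le_of_mem_configs (Finset.mem_filter.1 hη).1 y),
      pour_mem_crowded hxy hη⟩
  · intro p _
    have := (inv_pos.2 (a_pos α p.1)).le
    have := (weight_pos α p.2).le
    have := hφ p.1
    have := hΦ p.2
    positivity
  · intro η hη
    calc weight α η * (φ (η y) * Φ (pour x y η)) ≤ _ :=
          mul_le_mul_of_nonneg_right (weight_le_pour hα hxy hη) (mul_nonneg (hφ _) (hΦ _))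
      _ = _ := by ring

/-- The part of the Dirichlet form due to the jumps between `x` and `y`. -/
noncomputable def bondEnergy (α : ℝ) (N : ℕ) (h : (S → ℕ) → ℝ) (x y : S) : ℝ :=
  ∑ ξ ∈ configs S N, weight α ξ * (h (ξ + Pi.single y 1) - h (ξ + Pi.single x 1)) ^ 2

theorem bondEnergy_nonneg (α : ℝ) (N : ℕ) (h : (S → ℕ) → ℝ) (x y : S) :
    0 ≤ bondEnergy α N h x y :=
  Finset.sum_nonneg fun ξ _ => mul_nonneg (weight_pos α ξ).le (sq_nonneg _)

/-- Site y only loses particles, which raises the weight; at x the crowding bounds the loss. -/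
theorem weight_le_transfer {α : ℝ} (hα : 0 ≤ α) {N : ℕ} {x y : S} (hxy : y ≠ x) {η : S → ℕ}
    (hη : η ∈ crowded N x) {i : ℕ} (hi : i < η y) :
    weight α η ≤ (Fintype.card S : ℝ) ^ α * weight α (transfer x y (i + 1) i η) := by
  have h := weight_le_mul (α := α) (η := η) (ζ := transfer x y (i + 1) i η)
    (fun z => if z = x then (Fintype.card S : ℝ) ^ α else 1) fun z => ?_
  · rwa [Finset.prod_ite_eq', if_pos (Finset.mem_univ _)] at h
  · by_cases h1 : z = y
    · subst h1
      simp only [hxy, transfer, if_true, if_false, one_mul]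
      exact inv_anti₀ (a_pos _ _) (a_mono hα (Nat.sub_le _ _))
    · by_cases h2 : z = x
      · subst h2
        simp only [if_true]
        refine inv_a_le_of_crowded hα hη ?_
        have h3 := sum_transfer hxy (j := i) (show i + 1 ≤ η y from hi)
        have h4 := le_of_mem_configs (mem_configs.2 (rfl : _ = _)) z
          (η := transfer z y (i + 1) i η)
        have h5 := (mem_crowded.1 hη).1
        omega
      · simp [h1, h2, transfer]

/-- Telescope along the path moving particles one by one. One factor N + 1 comes from
Cauchy–Schwarz, the other from the number of steps; each step is injective in η, so it contributes
at most κ^α times the bond energy. -/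
theorem sum_crowded_sq_sub_pour_le {α : ℝ} (hα : 0 ≤ α) {N : ℕ} {x y : S} (hxy : y ≠ x)
    (h : (S → ℕ) → ℝ) :
    ∑ η ∈ crowded (N + 1) x, weight α η * (h η - h (pour x y η)) ^ 2 ≤
      (Fintype.card S : ℝ) ^ α * ((N : ℝ) + 1) ^ 2 * bondEnergy α N h x y := by
  set D : (S → ℕ) → ℝ := fun ξ => (h (ξ + Pi.single y 1) - h (ξ + Pi.single x 1)) ^ 2 with hD
  have hD0 : ∀ ξ, 0 ≤ D ξ := fun ξ => sq_nonneg _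
  -- The indicator i < η y makes the range of i independent of η, so that the sums can be exchanged.
  have step : ∀ η ∈ crowded (N + 1) x, weight α η * (h η - h (pour x y η)) ^ 2 ≤
      ((N : ℝ) + 1) * ∑ i ∈ Finset.range (N + 1),
        if i < η y then weight α η * D (transfer x y (i + 1) i η) else 0 := by
    intro η hη
    have hle : η y ≤ N + 1 := le_of_mem_configs (Finset.mem_filter.1 hη).1 y
    have h1 : h η - h (pour x y η) = ∑ i ∈ Finset.range (η y),
        (h (transfer x y i i η) - h (transfer x y (i + 1) (i + 1) η)) := by
      rw [Finset.sum_range_sub' (fun i => h (transfer x y i i η)), transfer_zero]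
      rfl
    have h2 : (h η - h (pour x y η)) ^ 2 ≤
        (η y : ℝ) * ∑ i ∈ Finset.range (η y), D (transfer x y (i + 1) i η) := by
      rw [h1]
      refine (sq_sum_le_card_mul_sum_sq).trans (le_of_eq ?_)
      rw [Finset.card_range]
      congr 1
      refine Finset.sum_congr rfl fun i hi => ?_
      rw [hD]
      dsimp only
      rw [transfer_add_single_left hxy, transfer_add_single_right _ (Finset.mem_range.1 hi)]
    have h3 : ∑ i ∈ Finset.range (N + 1),
        (if i < η y then weight α η * D (transfer x y (i + 1) i η) else 0) =
        weight α η * ∑ i ∈ Finset.range (η y), D (transfer x y (i + 1) i η) := by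
      rw [← Finset.sum_filter, Finset.mul_sum]
      refine Finset.sum_congr ?_ fun _ _ => rfl
      ext i
      simp only [Finset.mem_filter, Finset.mem_range]
      omega
    rw [h3]
    have h4 : (η y : ℝ) ≤ (N : ℝ) + 1 := by exact_mod_cast hle
    have h5 : 0 ≤ ∑ i ∈ Finset.range (η y), D (transfer x y (i + 1) i η) :=
      Finset.sum_nonneg fun _ _ => hD0 _
    calc _ ≤ weight α η * (((N : ℝ) + 1) * ∑ i ∈ Finset.range (η y), D (transfer x y (i + 1) i η)) :=
          mul_le_mul_of_nonneg_left (h2.trans (mul_le_mul_of_nonneg_right h4 h5))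
            (weight_pos α η).le
      _ = _ := by ring
  have layer : ∀ i, ∑ η ∈ crowded (N + 1) x,
      (if i < η y then weight α η * D (transfer x y (i + 1) i η) else 0) ≤
        (Fintype.card S : ℝ) ^ α * bondEnergy α N h x y := by
    intro i
    rw [← Finset.sum_filter, bondEnergy, Finset.mul_sum]
    refine sum_le_sum_of_injOn (transfer x y (i + 1) i) ?_ ?_ ?_ ?_
    · refine (transfer_injOn hxy _ _).mono fun η hη => ?_
      exact (Finset.mem_filter.1 hη).2
    · intro η hη
      rw [Finset.mem_filter] at hη
      have h3 := sum_transfer hxy (j := i) (show i + 1 ≤ η y from hη.2)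
      have h5 := (mem_crowded.1 hη.1).1
      rw [mem_configs]
      omega
    · intro ξ _
      have := (weight_pos α ξ).le
      positivity
    · intro η hη
      rw [Finset.mem_filter] at hη
      rw [← mul_assoc]
      exact mul_le_mul_of_nonneg_right (weight_le_transfer hα hxy hη.1 hη.2) (hD0 _)
  calc _ ≤ _ := Finset.sum_le_sum step
    _ = ((N : ℝ) + 1) * ∑ i ∈ Finset.range (N + 1), ∑ η ∈ crowded (N + 1) x,
        (if i < η y then weight α η * D (transfer x y (i + 1) i η) else 0) := by
      rw [← Finset.mul_sum, Finset.sum_comm]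
    _ ≤ ((N : ℝ) + 1) * ∑ i ∈ Finset.range (N + 1),
        (Fintype.card S : ℝ) ^ α * bondEnergy α N h x y :=
      mul_le_mul_of_nonneg_left (Finset.sum_le_sum fun i _ => layer i) (by positivity)
    _ = _ := by
      rw [Finset.sum_const, Finset.card_range]
      push_cast [nsmul_eq_mul]
      ring

end Weights

/-! ### Emptying several sites in succession. -/

section PourAll

variable {S : Type*} [DecidableEq S]

/-- All particles of the sites in a list are sent to `x`, one site after the other. -/
def pourAll (x : S) : List S → (S → ℕ) → S → ℕ
  | [], η => η
  | y :: L, η => pourAll x L (pour x y η)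

theorem pourAll_apply_eq_zero {x z : S} (hz : z ≠ x) (L : List S) (η : S → ℕ)
    (h : η z = 0 ∨ z ∈ L) : pourAll x L η z = 0 := by
  induction L generalizing η with
  | nil => simpa [pourAll] using h
  | cons y L ih =>
    refine ih _ ?_
    by_cases hy : z = y
    · subst hy; left; simp [pour, transfer]
    · rcases h with h | h
      · left; simp [pour, transfer, hz, hy, h]
      · right; simpa [hy] using h

end PourAll

/-! ### Poincaré-type estimate around a fully occupied site. -/

section Poincare

variable {S : Type*} [Fintype S] [DecidableEq S]

theorem pourAll_mem_crowded {N : ℕ} {x : S} {L : List S} (hL : ∀ y ∈ L, y ≠ x) {η : S → ℕ}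
    (hη : η ∈ crowded N x) : pourAll x L η ∈ crowded N x := by
  induction L generalizing η with
  | nil => exact hη
  | cons y L ih =>
    exact ih (fun z hz => hL z (List.mem_cons_of_mem _ hz))
      (pour_mem_crowded (hL y List.mem_cons_self) hη)

theorem pourAll_eq_single {N : ℕ} {x : S} {L : List S} (hL : ∀ y, y ∈ L ↔ y ≠ x) {η : S → ℕ}
    (hη : η ∈ crowded N x) : pourAll x L η = Pi.single x N := by
  have h0 : ∀ z, z ≠ x → pourAll x L η z = 0 := fun z hz =>
    pourAll_apply_eq_zero hz L η (Or.inr ((hL z).2 hz))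
  have h1 := (mem_crowded.1 (pourAll_mem_crowded (fun y hy => (hL y).1 hy) hη)).1
  rw [Finset.sum_eq_single x (fun z _ hz => h0 z hz) (by simp)] at h1
  ext z
  by_cases hz : z = x
  · subst hz; simpa using h1
  · rw [h0 z hz]; simp [hz]

theorem sum_crowded_pourAll_le {α : ℝ} (hα : 1 < α) {N : ℕ} {x : S} {L : List S}
    (hL : ∀ y ∈ L, y ≠ x) {Φ : (S → ℕ) → ℝ} (hΦ : ∀ η, 0 ≤ Φ η) :
    ∑ η ∈ crowded N x, weight α η * Φ (pourAll x L η) ≤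
      ((Fintype.card S : ℝ) ^ α * ∑' k, (a α k)⁻¹) ^ L.length *
        ∑ η ∈ crowded N x, weight α η * Φ η := by
  induction L with
  | nil => simp [pourAll]
  | cons y L ih =>
    have hs : ∑ k ∈ Finset.range (N + 1), 1 * (a α k)⁻¹ ≤ ∑' k, (a α k)⁻¹ := by
      simp only [one_mul]
      exact (summable_inv_a hα).sum_le_tsum _ fun k _ => (inv_pos.2 (a_pos _ _)).le
    have h1 := sum_crowded_pour_le (N := N) (zero_le_one.trans hα.le) (hL y List.mem_cons_self)
      (φ := fun _ => 1) (fun _ => zero_le_one) (Φ := fun η => Φ (pourAll x L η)) fun _ => hΦ _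
    simp only [one_mul] at h1 hs
    have h2 : 0 ≤ ∑ η ∈ crowded N x, weight α η * Φ (pourAll x L η) :=
      Finset.sum_nonneg fun η _ => mul_nonneg (weight_pos α η).le (hΦ _)
    have hA : 0 ≤ ∑' k, (a α k)⁻¹ := tsum_nonneg fun k => (inv_pos.2 (a_pos _ _)).le
    calc _ ≤ _ := h1
      _ ≤ ((Fintype.card S : ℝ) ^ α * ∑' k, (a α k)⁻¹) *
          ∑ η ∈ crowded N x, weight α η * Φ (pourAll x L η) := by gcongr
      _ ≤ ((Fintype.card S : ℝ) ^ α * ∑' k, (a α k)⁻¹) *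
          (((Fintype.card S : ℝ) ^ α * ∑' k, (a α k)⁻¹) ^ L.length *
            ∑ η ∈ crowded N x, weight α η * Φ η) :=
        mul_le_mul_of_nonneg_left (ih fun z hz => hL z (List.mem_cons_of_mem _ hz))
          (by positivity)
      _ = _ := by rw [List.length_cons]; ring

/-- Insert `pour x y η` between the end points: the first increment is a single pouring, and the
second is a function of `pour x y η`, whose sum is brought back to one over η by
`sum_crowded_pourAll_le` with the list [y]. -/
theorem exists_sum_crowded_sq_sub_pourAll_le {α : ℝ} (hα : 1 < α) {x : S} {L : List S}
    (hL : ∀ y ∈ L, y ≠ x) :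
    ∃ K : ℝ, 0 ≤ K ∧ ∀ (N : ℕ) (h : (S → ℕ) → ℝ),
      ∑ η ∈ crowded (N + 1) x, weight α η * (h η - h (pourAll x L η)) ^ 2 ≤
        K * (((N : ℝ) + 1) ^ 2 * ∑ y, bondEnergy α N h x y) := by
  induction L with
  | nil => exact ⟨0, le_rfl, fun N h => by simp [pourAll]⟩
  | cons y L ih =>
    obtain ⟨K, hK, ih⟩ := ih fun z hz => hL z (List.mem_cons_of_mem _ hz)
    have hy := hL y List.mem_cons_self
    have hα0 := zero_le_one.trans hα.le
    have hA : 0 ≤ ∑' k, (a α k)⁻¹ := tsum_nonneg fun k => (inv_pos.2 (a_pos _ _)).le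
    refine ⟨2 * (Fintype.card S : ℝ) ^ α + 2 * ((Fintype.card S : ℝ) ^ α * ∑' k, (a α k)⁻¹) * K,
      by positivity, fun N h => ?_⟩
    have h1 := sum_crowded_sq_sub_pour_le hα0 (N := N) hy h
    have h2 := sum_crowded_pourAll_le hα (N := N + 1) (x := x) (L := [y]) (by simpa using hy)
      (Φ := fun η => (h η - h (pourAll x L η)) ^ 2) fun _ => sq_nonneg _
    simp only [pourAll, List.length_singleton, pow_one] at h2
    have h3 : bondEnergy α N h x y ≤ ∑ y, bondEnergy α N h x y :=
      Finset.single_le_sum (f := fun y => bondEnergy α N h x y)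
        (fun y _ => bondEnergy_nonneg α N h x y) (Finset.mem_univ y)
    have h4 : ∑ η ∈ crowded (N + 1) x, weight α η * (h η - h (pourAll x (y :: L) η)) ^ 2 ≤
        2 * ∑ η ∈ crowded (N + 1) x, weight α η * (h η - h (pour x y η)) ^ 2 +
        2 * ∑ η ∈ crowded (N + 1) x,
          weight α η * (h (pour x y η) - h (pourAll x L (pour x y η))) ^ 2 := by
      rw [Finset.mul_sum, Finset.mul_sum, ← Finset.sum_add_distrib]
      refine Finset.sum_le_sum fun η _ => ?_
      have h5 : (h η - h (pourAll x (y :: L) η)) ^ 2 ≤ 2 * (h η - h (pour x y η)) ^ 2 +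
          2 * (h (pour x y η) - h (pourAll x L (pour x y η))) ^ 2 := by
        rw [pourAll]
        nlinarith [sq_nonneg ((h η - h (pour x y η)) -
          (h (pour x y η) - h (pourAll x L (pour x y η))))]
      calc _ ≤ _ := mul_le_mul_of_nonneg_left h5 (weight_pos α η).le
        _ = _ := by ring
    have h6 := mul_le_mul_of_nonneg_left (ih N h)
      (show 0 ≤ (Fintype.card S : ℝ) ^ α * ∑' k, (a α k)⁻¹ by positivity)
    have h7 := mul_le_mul_of_nonneg_left h3
      (show 0 ≤ (Fintype.card S : ℝ) ^ α * ((N : ℝ) + 1) ^ 2 by positivity)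
    linarith

theorem weight_single (α : ℝ) (x : S) (N : ℕ) : weight α (Pi.single x N) = (a α N)⁻¹ := by
  rw [weight, Finset.prod_eq_single x]
  · simp
  · intro z _ hz; simp [hz, a]
  · simp

theorem single_mem_configs (x : S) (N : ℕ) : Pi.single x N ∈ configs S N := by
  simp

/-- Pouring every other site sends all crowded configurations to Nδ_x, whose weight is 1/a(N); take
Φ to be its indicator. -/
theorem exists_sum_crowded_weight_le {α : ℝ} (hα : 1 < α) (x : S) :
    ∃ K : ℝ, 0 ≤ K ∧ ∀ N, ∑ η ∈ crowded N x, weight α η ≤ K * (a α N)⁻¹ := by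
  have hA : 0 ≤ ∑' k, (a α k)⁻¹ := tsum_nonneg fun k => (inv_pos.2 (a_pos _ _)).le
  set L := (Finset.univ.erase x).toList
  have hL : ∀ y, y ∈ L ↔ y ≠ x := fun y => by simp [L]
  refine ⟨((Fintype.card S : ℝ) ^ α * ∑' k, (a α k)⁻¹) ^ L.length, by positivity, fun N => ?_⟩
  have h := sum_crowded_pourAll_le hα (N := N) (fun y hy => (hL y).1 hy)
    (Φ := fun η => if η = Pi.single x N then 1 else 0) fun η => by split_ifs <;> simp
  calc ∑ η ∈ crowded N x, weight α η = ∑ η ∈ crowded N x, weight α η *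
        (if pourAll x L η = Pi.single x N then 1 else 0) :=
        Finset.sum_congr rfl fun η hη => by simp [pourAll_eq_single hL hη]
    _ ≤ _ := h
    _ ≤ _ := by
      refine mul_le_mul_of_nonneg_left ?_ (by positivity)
      simp only [mul_ite, mul_one, mul_zero]
      rw [Finset.sum_ite_eq']
      split_ifs
      · rw [weight_single]
      · exact (inv_pos.2 (a_pos _ _)).le

/-- If x misses more than l particles, some other site holds at least l/κ of them. Pouring that site
leaves a tail of ∑ 1/a(k) in place of the full series. -/
theorem exists_sum_crowded_filter_weight_le {α : ℝ} (hα : 1 < α) (x : S) :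
    ∃ K : ℝ, 0 ≤ K ∧ ∀ N l : ℕ,
      ∑ η ∈ (crowded N x).filter (fun η => ∀ z, η z + l < N), weight α η ≤
        K * (∑' i, (a α (i + l / Fintype.card S))⁻¹) * (a α N)⁻¹ := by
  obtain ⟨K, hK, h⟩ := exists_sum_crowded_weight_le hα x
  have hα0 := zero_le_one.trans hα.le
  refine ⟨Fintype.card S * ((Fintype.card S : ℝ) ^ α * K), by positivity, fun N l => ?_⟩
  set M := l / Fintype.card S
  have hT : 0 ≤ ∑' i, (a α (i + M))⁻¹ := tsum_nonneg fun k => (inv_pos.2 (a_pos _ _)).le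
  have h1 : ∀ y ∈ Finset.univ.erase x,
      ∑ η ∈ crowded N x, weight α η * (if M ≤ η y then 1 else 0) ≤
        (Fintype.card S : ℝ) ^ α * (∑' i, (a α (i + M))⁻¹) * (K * (a α N)⁻¹) := by
    intro y hy
    have h2 := sum_crowded_pour_le hα0 (N := N) (Finset.ne_of_mem_erase hy)
      (φ := fun k => if M ≤ k then 1 else 0) (fun k => by split_ifs <;> simp)
      (Φ := fun _ => 1) fun _ => zero_le_one
    simp only [mul_one] at h2
    refine h2.trans (mul_le_mul (mul_le_mul_of_nonneg_left ?_ (by positivity)) (h N)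
      (Finset.sum_nonneg fun η _ => (weight_pos α η).le) (by positivity))
    exact sum_range_ite_le_tsum_add (summable_inv_a hα) (fun k => (inv_pos.2 (a_pos _ _)).le) M _
  calc ∑ η ∈ (crowded N x).filter (fun η => ∀ z, η z + l < N), weight α η
      ≤ ∑ η ∈ crowded N x, ∑ y ∈ Finset.univ.erase x,
          weight α η * (if M ≤ η y then 1 else 0) := by
        rw [Finset.sum_filter]
        refine Finset.sum_le_sum fun η hη => ?_
        have h0 : ∀ y ∈ Finset.univ.erase x, 0 ≤ weight α η * (if M ≤ η y then 1 else 0) :=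
          fun y _ => mul_nonneg (weight_pos α η).le (by split_ifs <;> simp)
        split_ifs with hl
        · obtain ⟨y, hy, hMy⟩ : ∃ y ∈ Finset.univ.erase x, M ≤ η y := by
            by_contra! hcon
            have h3 : ∑ y ∈ Finset.univ.erase x, η y ≤ ∑ _y ∈ Finset.univ.erase x, M :=
              Finset.sum_le_sum fun y hy => (hcon y hy).le
            have h4 : ∑ _y ∈ Finset.univ.erase x, M ≤ l := by
              rw [Finset.sum_const, smul_eq_mul]
              refine le_trans (Nat.mul_le_mul_right _ (Finset.card_le_univ _)) ?_
              exact Nat.mul_div_le l _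
            have h5 := Finset.add_sum_erase _ η (Finset.mem_univ x)
            have h6 := (mem_crowded.1 hη).1
            have h7 := hl x
            omega
          refine le_trans (le_of_eq ?_) (Finset.single_le_sum h0 hy)
          simp [hMy]
        · exact Finset.sum_nonneg h0
    _ = ∑ y ∈ Finset.univ.erase x, ∑ η ∈ crowded N x,
          weight α η * (if M ≤ η y then 1 else 0) := Finset.sum_comm
    _ ≤ ∑ y ∈ Finset.univ.erase x,
          (Fintype.card S : ℝ) ^ α * (∑' i, (a α (i + M))⁻¹) * (K * (a α N)⁻¹) :=
        Finset.sum_le_sum h1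
    _ ≤ Fintype.card S *
          ((Fintype.card S : ℝ) ^ α * (∑' i, (a α (i + M))⁻¹) * (K * (a α N)⁻¹)) := by
        rw [Finset.sum_const, nsmul_eq_mul]
        have := (inv_pos.2 (a_pos α N)).le
        refine mul_le_mul_of_nonneg_right ?_ (by positivity)
        exact_mod_cast Finset.card_le_univ _
    _ = _ := by ring

/-- A function with `L²`-norm at most one has little mass outside the valleys if its Dirichlet form
is small. -/
theorem exists_sum_outside_le {α : ℝ} (hα : 1 < α) [Nonempty S] :
    ∃ K : ℝ, 0 ≤ K ∧ ∀ (N l : ℕ) (h : (S → ℕ) → ℝ),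
      ∑ η ∈ configs S (N + 1), weight α η * h η ^ 2 ≤ 1 →
      ∑ η ∈ (configs S (N + 1)).filter (fun η => ∀ z, η z + l < N + 1), weight α η * h η ^ 2 ≤
        K * (((N : ℝ) + 1) ^ 2 * ∑ x, ∑ y, bondEnergy α N h x y +
          ∑' i, (a α (i + l / Fintype.card S))⁻¹) := by
  set L : S → List S := fun x => (Finset.univ.erase x).toList
  have hL : ∀ x y, y ∈ L x ↔ y ≠ x := fun x y => by simp [L]
  choose K₁ hK₁ h₁ using fun x : S =>
    exists_sum_crowded_sq_sub_pourAll_le hα (L := L x) fun y hy => (hL x y).1 hy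
  choose K₂ hK₂ h₂ using fun x : S => exists_sum_crowded_filter_weight_le hα x
  refine ⟨2 * ∑ x, (K₁ x + K₂ x), mul_nonneg zero_le_two
    (Finset.sum_nonneg fun x _ => add_nonneg (hK₁ x) (hK₂ x)), fun N l h hh => ?_⟩
  set E := ((N : ℝ) + 1) ^ 2 * ∑ x, ∑ y, bondEnergy α N h x y with hE
  set T := ∑' i, (a α (i + l / Fintype.card S))⁻¹ with hT
  have hE0 : 0 ≤ E := mul_nonneg (by positivity)
    (Finset.sum_nonneg fun x _ => Finset.sum_nonneg fun y _ => bondEnergy_nonneg α N h x y)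
  have hT0 : 0 ≤ T := tsum_nonneg fun k => (inv_pos.2 (a_pos _ _)).le
  have hsite : ∀ x, ∑ η ∈ (crowded (N + 1) x).filter (fun η => ∀ z, η z + l < N + 1),
      weight α η * h η ^ 2 ≤ 2 * (K₁ x + K₂ x) * (E + T) := by
    intro x
    -- A single term of the normalisation bounds h at Nδ_x; this a(N) cancels the 1/a(N) in the
    -- weight of the bad set.
    have hs : h (Pi.single x (N + 1)) ^ 2 ≤ a α (N + 1) := by
      have h3 := (Finset.single_le_sum (f := fun η => weight α η * h η ^ 2)
        (fun η _ => mul_nonneg (weight_pos α η).le (sq_nonneg _))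
        (single_mem_configs x (N + 1))).trans hh
      simp only [weight_single] at h3
      rwa [inv_mul_le_iff₀ (a_pos _ _), mul_one] at h3
    have e1 : ∑ η ∈ (crowded (N + 1) x).filter (fun η => ∀ z, η z + l < N + 1),
        weight α η * (h η - h (pourAll x (L x) η)) ^ 2 ≤ K₁ x * E := by
      refine (Finset.sum_le_sum_of_subset_of_nonneg (Finset.filter_subset _ _) fun η _ _ =>
        mul_nonneg (weight_pos α η).le (sq_nonneg _)).trans ((h₁ x N h).trans ?_)
      refine mul_le_mul_of_nonneg_left (mul_le_mul_of_nonneg_left ?_ (by positivity)) (hK₁ x)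
      exact Finset.single_le_sum (f := fun x => ∑ y, bondEnergy α N h x y)
        (fun x _ => Finset.sum_nonneg fun y _ => bondEnergy_nonneg α N h x y) (Finset.mem_univ x)
    have e2 : a α (N + 1) * ∑ η ∈ (crowded (N + 1) x).filter (fun η => ∀ z, η z + l < N + 1),
        weight α η ≤ K₂ x * T := by
      have h3 := mul_le_mul_of_nonneg_left (h₂ x (N + 1) l) (a_pos α (N + 1)).le
      have h4 := (a_pos α (N + 1)).ne'
      refine h3.trans (le_of_eq ?_)
      rw [← hT]
      field_simp
    have e3 : ∑ η ∈ (crowded (N + 1) x).filter (fun η => ∀ z, η z + l < N + 1),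
        weight α η * h η ^ 2 ≤
        2 * ∑ η ∈ (crowded (N + 1) x).filter (fun η => ∀ z, η z + l < N + 1),
          weight α η * (h η - h (pourAll x (L x) η)) ^ 2 +
        2 * (a α (N + 1) * ∑ η ∈ (crowded (N + 1) x).filter (fun η => ∀ z, η z + l < N + 1),
          weight α η) := by
      simp only [Finset.mul_sum]
      rw [← Finset.sum_add_distrib]
      refine Finset.sum_le_sum fun η hη => ?_
      have h4 : h η ^ 2 ≤ 2 * (h η - h (pourAll x (L x) η)) ^ 2 + 2 * a α (N + 1) := by
        rw [pourAll_eq_single (hL x) (Finset.mem_filter.1 hη).1]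
        nlinarith [sq_nonneg ((h η - h (Pi.single x (N + 1))) - h (Pi.single x (N + 1)))]
      calc _ ≤ _ := mul_le_mul_of_nonneg_left h4 (weight_pos α η).le
        _ = _ := by ring
    nlinarith [mul_nonneg (hK₁ x) hT0, mul_nonneg (hK₂ x) hE0]
  -- Several sites may be crowded; choosing one for each η embeds the sum in the sum over sites.
  choose! site hsite' using fun (η : S → ℕ) (hη : η ∈ configs S (N + 1)) => exists_mem_crowded hη
  have hw : ∀ η : S → ℕ, 0 ≤ weight α η * h η ^ 2 := fun η =>
    mul_nonneg (weight_pos α η).le (sq_nonneg _)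
  calc _ ≤ ∑ x, ∑ η ∈ (crowded (N + 1) x).filter (fun η => ∀ z, η z + l < N + 1),
        weight α η * h η ^ 2 := by
        rw [Finset.sum_sigma']
        refine sum_le_sum_of_injOn (fun η => ⟨site η, η⟩) ?_ ?_ (fun p _ => hw p.2)
          fun η _ => le_rfl
        · intro η _ ζ _ hηζ
          simp only [Sigma.mk.injEq, heq_eq_eq] at hηζ
          exact hηζ.2
        · intro η hη
          rw [Finset.mem_filter] at hη
          exact Finset.mem_sigma.2 ⟨Finset.mem_univ _,
            Finset.mem_filter.2 ⟨hsite' η hη.1, hη.2⟩⟩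
    _ ≤ ∑ x, 2 * (K₁ x + K₂ x) * (E + T) := Finset.sum_le_sum fun x _ => hsite x
    _ = _ := by rw [← Finset.sum_mul, ← Finset.mul_sum]

end Poincare

/-! ### The generator, its Dirichlet form and the rate function. -/

section Jump

variable {S : Type*} [DecidableEq S]

/-- The jump of a particle from `x` to `y`, on unrestricted occupation functions. -/
def jump (x y : S) (η : S → ℕ) : S → ℕ :=
  if η x = 0 then η else fun z => (η z - if z = x then 1 else 0) + if z = y then 1 else 0

theorem jump_add_single (x y : S) (ξ : S → ℕ) :
    jump x y (ξ + Pi.single x 1) = ξ + Pi.single y 1 := by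
  ext z
  have h : (ξ + Pi.single x 1 : S → ℕ) x ≠ 0 := by simp
  rw [jump, if_neg h]
  simp [Pi.single_apply]

end Jump

section Generator

variable {S : Type*} [Fintype S] [DecidableEq S]

/-- Since g(n)/a(n) = 1/a(n-1), the weighted jump rate out of x depends only on the configuration ξ
left behind, not on x. -/
theorem weight_add_single_mul_g (α : ℝ) (x : S) (ξ : S → ℕ) :
    weight α (ξ + Pi.single x 1) * g α ((ξ + Pi.single x 1 : S → ℕ) x) = weight α ξ := by
  have h1 : ∏ z ∈ Finset.univ.erase x, (a α ((ξ + Pi.single x 1 : S → ℕ) z))⁻¹ =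
      ∏ z ∈ Finset.univ.erase x, (a α (ξ z))⁻¹ :=
    Finset.prod_congr rfl fun z hz => by simp [Finset.ne_of_mem_erase hz]
  rw [weight, weight, ← Finset.mul_prod_erase _ _ (Finset.mem_univ x), h1,
    ← Finset.mul_prod_erase Finset.univ (fun z => (a α (ξ z))⁻¹) (Finset.mem_univ x)]
  have h2 := (a_pos α (ξ x + 1)).ne'
  simp [g]
  field_simp

theorem sum_configs_jump (α : ℝ) (N : ℕ) (h : (S → ℕ) → ℝ) (x y : S) :
    ∑ η ∈ configs S (N + 1), weight α η * g α (η x) * (h η * (h η - h (jump x y η))) =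
      ∑ ξ ∈ configs S N, weight α ξ *
        (h (ξ + Pi.single x 1) * (h (ξ + Pi.single x 1) - h (ξ + Pi.single y 1))) := by
  symm
  refine Finset.sum_of_injOn (fun ξ => ξ + Pi.single x 1) (add_left_injective _).injOn ?_ ?_ ?_
  · intro ξ hξ
    simp only [Finset.mem_coe, mem_configs] at hξ ⊢
    simp [Finset.sum_add_distrib, hξ]
  · intro η hη hn
    -- Configurations outside the image have x empty. Although g(0) = 1, their terms vanish because
    -- the jump fixes them.
    have h0 : η x = 0 := by
      by_contra h0
      refine hn ⟨η - Pi.single x 1, ?_, ?_⟩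
      · have h1 : η - Pi.single x 1 + Pi.single x 1 = η := by
          ext z
          by_cases hz : z = x
          · subst hz; simp; omega
          · simp [hz]
        have h2 : ∑ z, (η - Pi.single x 1 + Pi.single x 1 : S → ℕ) z = N + 1 := by
          rw [h1]; exact mem_configs.1 hη
        simp only [Finset.mem_coe, mem_configs]
        simpa [Finset.sum_add_distrib] using h2
      · ext z
        by_cases hz : z = x
        · subst hz; simp; omega
        · simp [hz]
    simp [jump, h0]
  · intro ξ _
    rw [weight_add_single_mul_g, jump_add_single]

/-- The value at `η` of minus the generator applied to `h`. -/
noncomputable def drift (α : ℝ) (r : S → S → ℝ) (h : (S → ℕ) → ℝ) (η : S → ℕ) : ℝ :=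
  ∑ x, ∑ y, g α (η x) * r x y * (h η - h (jump x y η))

/-- For each fixed ξ the inner sum is the Dirichlet form on S of z ↦ h(ξ + δ_z), to which the
comparison of increments applies. -/
theorem sum_configs_drift (α : ℝ) (r : S → S → ℝ) (N : ℕ) (h : (S → ℕ) → ℝ) :
    ∑ η ∈ configs S (N + 1), weight α η * (h η * drift α r h η) =
      ∑ ξ ∈ configs S N, weight α ξ * ∑ x, ∑ y, r x y *
        (h (ξ + Pi.single x 1) * (h (ξ + Pi.single x 1) - h (ξ + Pi.single y 1))) := by
  simp only [drift, Finset.mul_sum]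
  rw [Finset.sum_comm, Finset.sum_comm (s := configs S N)]
  refine Finset.sum_congr rfl fun x _ => ?_
  rw [Finset.sum_comm, Finset.sum_comm (s := configs S N)]
  refine Finset.sum_congr rfl fun y _ => ?_
  have h1 := congrArg (r x y * ·) (sum_configs_jump α N h x y)
  simp only [Finset.mul_sum] at h1
  refine Eq.trans (Finset.sum_congr rfl fun η _ => by ring) (h1.trans ?_)
  exact Finset.sum_congr rfl fun η _ => by ring

theorem exists_bondEnergy_le {r : S → S → ℝ} (hr : IsIrreducibleRates r)
    (h2 : ∀ y, ∑ x, r x y = 0) :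
    ∃ K : ℝ, 0 ≤ K ∧ ∀ (α : ℝ) (N : ℕ) (h : (S → ℕ) → ℝ) (x y : S),
      bondEnergy α N h x y ≤
        K * ∑ η ∈ configs S (N + 1), weight α η * (h η * drift α r h η) := by
  obtain ⟨K, hK, hF⟩ := hr.exists_sq_sub_le h2
  refine ⟨K, hK, fun α N h x y => ?_⟩
  rw [sum_configs_drift, bondEnergy, Finset.mul_sum]
  refine Finset.sum_le_sum fun ξ _ => ?_
  calc _ ≤ _ := mul_le_mul_of_nonneg_left (hF (fun z => h (ξ + Pi.single z 1)) y x)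
        (weight_pos α ξ).le
    _ = _ := by ring

instance (N : ℕ) : Finite (Config S N) :=
  Finite.of_equiv (configs S N) (Equiv.subtypeEquivRight fun _ => mem_configs)

/-- The mass function of a measure on configurations, on unrestricted occupation functions. -/
noncomputable def mass {N : ℕ} (ν : Measure (Config S N)) (η : S → ℕ) : ℝ :=
  ν.real (Subtype.val ⁻¹' {η})

theorem integral_config {N : ℕ} (ν : Measure (Config S N)) [IsFiniteMeasure ν]
    (F : (S → ℕ) → ℝ) : ∫ η, F η.1 ∂ν = ∑ η ∈ configs S N, mass ν η * F η := by
  have := Fintype.ofFinite (Config S N)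
  have h1 := Finset.sum_subtype (configs S N) (p := fun η => ∑ x, η x = N) (F := this)
    (fun η => mem_configs) fun η => mass ν η * F η
  rw [integral_fintype Integrable.of_finite, h1]
  refine Finset.sum_congr (by ext; simp) fun η _ => ?_
  have h : (Subtype.val ⁻¹' {η.1} : Set (Config S N)) = {η} := by
    ext ζ; simp [Subtype.ext_iff]
  rw [mass, h, smul_eq_mul]

/-- The square root of the density of a measure with respect to the stationary weights. -/
noncomputable def sqrtDensity (α : ℝ) {N : ℕ} (ν : Measure (Config S N)) (η : S → ℕ) : ℝ :=
  √(mass ν η / weight α η)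

theorem weight_mul_sqrtDensity_sq (α : ℝ) {N : ℕ} (ν : Measure (Config S N)) (η : S → ℕ) :
    weight α η * sqrtDensity α ν η ^ 2 = mass ν η := by
  rw [sqrtDensity, Real.sq_sqrt (div_nonneg (show 0 ≤ mass ν η from measureReal_nonneg) (weight_pos _ _).le),
    mul_div_cancel₀ _ (weight_pos α η).ne']

/-- The Dirichlet form of the square root of the density is below the rate function. -/
theorem sum_sqrtDensity_drift_le {α : ℝ} {r : S → S → ℝ} {N : ℕ} (ν : Measure (Config S N))
    [IsFiniteMeasure ν] {B : ℝ}
    (hB : ∀ u : Config S N → ℝ, (∀ η, 0 < u η) → ∫ η, -(generator α r N u η / u η) ∂ν ≤ B) :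
    ∑ η ∈ configs S N, weight α η *
      (sqrtDensity α ν η * drift α r (sqrtDensity α ν) η) ≤ B := by
  set h := sqrtDensity α ν with hh
  have h0 : ∀ η, 0 ≤ h η := fun η => Real.sqrt_nonneg _
  -- The shift by ε keeps the test function positive where h = 0; there the mass is also 0, so the
  -- term is 0 for every ε.
  have hlim : Tendsto (fun ε : ℝ => ∑ η ∈ configs S N,
      mass ν η * (drift α r h η / (h η + ε))) (𝓝[>] 0)
      (𝓝 (∑ η ∈ configs S N, weight α η * (h η * drift α r h η))) := by
    refine tendsto_finsetSum _ fun η _ => ?_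
    rcases (h0 η).eq_or_lt with hz | hz
    · have : mass ν η = 0 := by
        rw [← weight_mul_sqrtDensity_sq α ν η, ← hh, ← hz]; simp
      simp [this, ← hz]
    · have h1 : Tendsto (fun ε : ℝ => mass ν η * (drift α r h η / (h η + ε))) (𝓝 0)
          (𝓝 (mass ν η * (drift α r h η / (h η + 0)))) :=
        tendsto_const_nhds.mul (tendsto_const_nhds.div (tendsto_const_nhds.add tendsto_id)
          (by simpa using hz.ne'))
      have h2 : mass ν η * (drift α r h η / (h η + 0)) = weight α η * (h η * drift α r h η) := by
        rw [← weight_mul_sqrtDensity_sq α ν η, ← hh, add_zero]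
        field_simp
      rw [← h2]
      exact h1.mono_left nhdsWithin_le_nhds
  refine le_of_tendsto hlim ?_
  filter_upwards [self_mem_nhdsWithin] with ε hε
  have h3 := hB (fun η => h η.1 + ε) fun η => add_pos_of_nonneg_of_pos (h0 _) hε
  refine le_trans (le_of_eq ?_) h3
  rw [← integral_config]
  congr 1
  ext η
  rw [← neg_div]
  congr 1
  rw [drift, generator]
  simp only [← Finset.sum_neg_distrib]
  refine Finset.sum_congr rfl fun x _ => Finset.sum_congr rfl fun y _ => ?_
  have h4 : (η.move x y).1 = jump x y η.1 := rfl
  rw [h4]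
  ring

theorem real_outside_valley {N : ℕ} (ν : Measure (Config S N)) [IsFiniteMeasure ν] (l : ℕ) :
    ν.real (outside fun x : S => valley N l x) =
      ∑ η ∈ (configs S N).filter (fun η => ∀ z, η z + l < N), mass ν η := by
  classical
  have hset : outside (fun x : S => valley N l x) =
      {η : Config S N | ∀ z, η.1 z + l < N} := by
    ext η
    simp only [outside, valley, Set.mem_compl_iff, Set.mem_iUnion, not_exists]
    refine forall_congr' fun z => ?_
    show ¬ ((N : ℤ) - l ≤ η.1 z) ↔ η.1 z + l < N
    omega
  have hm : MeasurableSet {η : Config S N | ∀ z, η.1 z + l < N} :=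
    (Set.toFinite _).measurableSet
  rw [hset, ← integral_indicator_one hm, Finset.sum_filter]
  have h := integral_config ν fun η => if ∀ z, η z + l < N then 1 else 0
  simp only [mul_ite, mul_one, mul_zero] at h
  rw [← h]
  refine integral_congr_ae (Eventually.of_forall fun η => ?_)
  simp [Set.indicator_apply]

/-- A measure of small rate function has little mass outside the valleys. -/
theorem exists_real_outside_valley_le [Nonempty S] {α : ℝ} (hα : 1 < α) {r : S → S → ℝ}
    (hr : IsIrreducibleRates r) (h2 : ∀ y, ∑ x, r x y = 0) :
    ∃ K : ℝ, 0 ≤ K ∧ ∀ (N l : ℕ) (ν : Measure (Config S N)) [IsProbabilityMeasure ν] (B : ℝ),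
      N ≠ 0 →
      (∀ u : Config S N → ℝ, (∀ η, 0 < u η) → ∫ η, -(generator α r N u η / u η) ∂ν ≤ B) →
      ν.real (outside fun x : S => valley N l x) ≤
        K * ((N : ℝ) ^ 2 * B + ∑' i, (a α (i + l / Fintype.card S))⁻¹) := by
  obtain ⟨K₁, hK₁, h₁⟩ := exists_sum_outside_le (S := S) hα
  obtain ⟨K₂, hK₂, h₂⟩ := exists_bondEnergy_le hr h2
  set κ : ℝ := (Fintype.card S : ℝ)
  refine ⟨K₁ * (κ * κ * K₂ + 1), by positivity, fun N l ν _ B hN hB => ?_⟩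
  obtain ⟨N, rfl⟩ := Nat.exists_eq_succ_of_ne_zero hN
  set T := ∑' i, (a α (i + l / Fintype.card S))⁻¹
  have hT0 : 0 ≤ T := tsum_nonneg fun k => (inv_pos.2 (a_pos _ _)).le
  -- Test with u = 1, which the generator annihilates.
  have hB0 : 0 ≤ B := by
    simpa [generator] using hB (fun _ => 1) fun _ => one_pos
  have hone : ∑ η ∈ configs S (N + 1), weight α η * sqrtDensity α ν η ^ 2 ≤ 1 := by
    have h := integral_config ν fun _ => 1
    simp only [weight_mul_sqrtDensity_sq]
    simpa using h.symm.le
  have h3 := h₁ N l (sqrtDensity α ν) hone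
  simp only [weight_mul_sqrtDensity_sq] at h3
  have h4 : ∑ x, ∑ y, bondEnergy α N (sqrtDensity α ν) x y ≤ κ * κ * K₂ * B := by
    calc ∑ x, ∑ y, bondEnergy α N (sqrtDensity α ν) x y ≤ ∑ _x : S, ∑ _y : S, K₂ * B :=
          Finset.sum_le_sum fun x _ => Finset.sum_le_sum fun y _ => (h₂ α N _ x y).trans
            (mul_le_mul_of_nonneg_left (sum_sqrtDensity_drift_le ν hB) hK₂)
      _ = _ := by simp [κ]; ring
  rw [real_outside_valley]
  refine h3.trans ?_
  rw [mul_assoc]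
  refine mul_le_mul_of_nonneg_left ?_ hK₁
  push_cast
  have h5 := mul_le_mul_of_nonneg_left h4 (show (0 : ℝ) ≤ ((N : ℝ) + 1) ^ 2 by positivity)
  have h6 : 0 ≤ ((N : ℝ) + 1) ^ 2 * B := by positivity
  have h7 : 0 ≤ κ * κ * K₂ * T := by positivity
  linarith

theorem tendsto_outside_valley [Nonempty S] {α : ℝ} (hα : 1 < α) {r : S → S → ℝ}
    (hr : IsIrreducibleRates r) (h2 : ∀ y, ∑ x, r x y = 0) {ℓ : ℕ → ℕ}
    (hℓ : Tendsto ℓ atTop atTop) {n : ℕ → ℕ} (hn : StrictMono n)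
    (ν : ∀ k, ProbabilityMeasure (Config S (n k))) {C : ℝ}
    (hC : ∀ k, ∀ u : Config S (n k) → ℝ, (∀ η, 0 < u η) →
      (n k : ℝ) ^ (1 + α) *
        ∫ η, -(generator α r (n k) u η / u η) ∂(ν k : Measure (Config S (n k))) ≤ C) :
    Tendsto (fun k => (ν k : Measure (Config S (n k)))
      (outside fun x : S => valley (n k) (ℓ (n k)) x)) atTop (𝓝 0) := by
  obtain ⟨K, hK, h⟩ := exists_real_outside_valley_le hα hr h2
  have hn' := hn.tendsto_atTop
  set b : ℕ → ℝ := fun N =>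
    K * ((N : ℝ) ^ (-(α - 1)) * C + ∑' i, (a α (i + ℓ N / Fintype.card S))⁻¹) with hb
  have hb0 : Tendsto b atTop (𝓝 0) := by
    have h1 : Tendsto (fun N : ℕ => (N : ℝ) ^ (-(α - 1))) atTop (𝓝 0) :=
      (tendsto_rpow_neg_atTop (by linarith)).comp tendsto_natCast_atTop_atTop
    have h3 : Tendsto (fun N => ∑' i, (a α (i + ℓ N / Fintype.card S))⁻¹) atTop (𝓝 0) :=
      (tendsto_sum_nat_add fun i => (a α i)⁻¹).comp
        ((Nat.tendsto_div_const_atTop Fintype.card_ne_zero).comp hℓ)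
    simpa [hb] using ((h1.mul_const C).add h3).const_mul K
  have hb1 : Tendsto (fun k => ENNReal.ofReal (b (n k))) atTop (𝓝 0) := by
    simpa using ENNReal.tendsto_ofReal (hb0.comp hn')
  refine tendsto_of_tendsto_of_tendsto_of_le_of_le' tendsto_const_nhds hb1
    (Eventually.of_forall fun _ => zero_le) ?_
  -- The sequence may start at 0, where the bound is not available.
  filter_upwards [hn'.eventually_ne_atTop 0] with k hk
  have hpos : (0 : ℝ) < n k := by exact_mod_cast Nat.pos_of_ne_zero hk
  have h3 := h (n k) (ℓ (n k)) (ν k : Measure (Config S (n k))) ((n k : ℝ) ^ (-(1 + α)) * C) hk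
    fun u hu => by
      rw [Real.rpow_neg hpos.le, inv_mul_eq_div, le_div_iff₀' (Real.rpow_pos_of_pos hpos _)]
      exact hC k u hu
  rw [← mul_assoc, ← Real.rpow_natCast, ← Real.rpow_add hpos] at h3
  have h4 : ((2 : ℕ) : ℝ) + -(1 + α) = -(α - 1) := by push_cast; ring
  rw [h4] at h3
  rw [← ofReal_measureReal (measure_ne_top _ _)]
  exact ENNReal.ofReal_le_ofReal h3

end Generator

end ZeroRange

theorem mainTheorem10 {S : Type*} [Fintype S] [DecidableEq S] (hκ : 2 ≤ Fintype.card S)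
    (α : ℝ) (hα : 1 < α)
    (r : S → S → ℝ) (hr : ZeroRange.IsIrreducibleRates r)
    (hm : (∀ x y, r x y = r y x) ∨
      ZeroRange.IsInvariant r (fun _ => ((Fintype.card S : ℕ) : ℝ)⁻¹))
    (ℓ : ℕ → ℕ) (hℓ_top : Tendsto ℓ atTop atTop)
    (hℓ_small : Tendsto (fun N => (ℓ N : ℝ) / (N : ℝ)) atTop (𝓝 0)) :
    (∀ n : ℕ → ℕ, StrictMono n →
      ∀ ν : ∀ k, ProbabilityMeasure (ZeroRange.Config S (n k)),
      ∀ C : ℝ, 0 < C →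
        (∀ k, (((n k : ℝ) ^ (1 + α) : ℝ) : EReal) *
          ZeroRange.rateFunction (ZeroRange.generator α r (n k)) (ν k) < (C : EReal)) →
        Tendsto (fun k => (ν k : Measure (ZeroRange.Config S (n k)))
          (ZeroRange.outside (fun x : S => ZeroRange.valley (n k) (ℓ (n k)) x))) atTop (𝓝 0)) ∧
    ZeroRange.ConditionM0Star
      (fun N (f : ZeroRange.Config S N → ℝ) η =>
        (N : ℝ) ^ (1 + α) * ZeroRange.generator α r N f η)
      (fun N (x : S) => ZeroRange.valley N (ℓ N) x) := by
  have hpos : 0 < Fintype.card S := by omega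
  have : Nonempty S := Fintype.card_pos_iff.1 hpos
  -- Both alternatives enter only through vanishing column sums.
  have h2 : ∀ y, ∑ x, r x y = 0 := fun y => by
    rcases hm with hm | hm
    · simp only [hm _ y, hr.sum_eq_zero]
    · have h := hm y
      rw [← Finset.mul_sum] at h
      exact (mul_eq_zero.1 h).resolve_left (by positivity)
  refine ⟨fun n hn ν C _ hC => ?_, fun n hn _ ν hν => ?_⟩
  · refine ZeroRange.tendsto_outside_valley hα hr h2 hℓ_top hn ν (C := C) fun k u hu => ?_
    rw [← EReal.coe_le_coe_iff, EReal.coe_mul]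
    refine le_trans (mul_le_mul_of_nonneg_left ?_ ?_) (hC k).le
    · exact le_iSup (fun u : {u : ZeroRange.Config S (n k) → ℝ // ∀ η, 0 < u η} =>
        ((∫ η, -(ZeroRange.generator α r (n k) u.1 η / u.1 η)
          ∂(ν k : Measure (ZeroRange.Config S (n k))) : ℝ) : EReal)) ⟨u, hu⟩
    · exact EReal.coe_nonneg.2 (by positivity)
  -- The finite supremum, read as a real number, is the constant C; the time acceleration is pulled
  -- out of the integral.
  · refine Tendsto.limsup_eq (ZeroRange.tendsto_outside_valley hα hr h2 hℓ_top hn ν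
      (C := (⨆ k, ZeroRange.rateFunction (fun (f : ZeroRange.Config S (n k) → ℝ) η =>
        (n k : ℝ) ^ (1 + α) * ZeroRange.generator α r (n k) f η) (ν k)).toReal) fun k u hu => ?_)
    rw [← EReal.coe_le_coe_iff]
    refine le_trans ?_ (EReal.le_coe_toReal hν.ne)
    refine le_trans ?_ (le_iSup _ k)
    refine le_trans (le_of_eq ?_) (le_iSup _ (⟨u, hu⟩ :
      {u : ZeroRange.Config S (n k) → ℝ // ∀ η, 0 < u η}))
    rw [← integral_const_mul]
    congr 2
    ext η
    ring
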